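/- **Setting.** Let $n,d_W\ge 1$, $d_{\perp}\ge 0$, let $(\Omega,\mathcal F,\mathbb P)$ be a probability space carrying independent standard Brownian motions $W$ (in $\mathbb R^{d_W}$) and $W^{\perp}$ (in $\mathbb R^{d_\perp}$), and let $\mathbb F=(\mathcal F_t)_{t\ge0}$ be the filtration generated by $(W,W^\perp)$, augmented by the null events. The market has zero interest rate and $n$ stocks with positive prices $\frac{dS^i_t}{S^i_t}=\mu^i_t\,dt+\sum_{j=1}^{d_W}\sigma^{ji}_t\,dW^j_t$, where $\mu$ and $\sigma$ are continuous and $\mathbb F$-adapted, and $\lambda_t=(\sigma_t^{+})^{\top}\mu_t$ ($\sigma_t^+$ the Moore–Penrose inverse) satisfies, almost surely, $\sup_{t\le T}\|\lambda_t\|<\infty$ for all $T>0$. Fix an initial capital $x_0>0$. An $\mathbb F$-progressively measurable portfolio $\pi$ (fractions of wealth) has wealth process $X^\pi$ given by $$dX^\pi_t=X^\pi_t(\sigma_t\pi_t)^\top\lambda_t\,dt+X^\pi_t(\sigma_t\pi_t)^\top dW_t,\qquad X^\pi_0=x_0,$$ and is admissible, $\pi\in\mathcal A$, if almost surely $X^\pi_t\ge0$,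 $\int_0^t|X^\pi_s\pi_s^\top\mu_s|\,ds<\infty$ and $\int_0^t|X^\pi_s\sigma_s\pi_s|^2\,ds<\infty$ for all $t\ge 0$. A random field $U_t(x)$, $t\ge0$, $x>0$, that is $\mathbb F$-progressively measurable for each $x$ (with $U_t(0)$ understood as the continuous extension), is a *forward performance process* (FPP) if (a) with probability one, for all $t\ge0$ the function $x\mapsto U_t(x)$ is strictly concave and strictly increasing on $(0,\infty)$; (b) $(U_t(X^\pi_t))_{t\ge0}$ is an $\mathbb F$-supermartingale for every $\pi\in\mathcal A$; (c) $(U_t(X^{\pi^*}_t))_{t\ge0}$ is an $\mathbb F$-martingale for some $\pi^*\in\mathcal A$. **Lemma 4.1.** Let $A,D,p,q$ be real-valued continuous $\mathbb F$-adapted processes such that, almost surely, $0<p_t<1$, $0<q_t<1$ and $p_t\le q_t$ for all $t\ge 0$. If $U_t(x)=A_tx^{p_t}+D_tx^{q_t}$ is a forward performance process, then with probability one, for all $t\ge0$: $A_t\ge0$ and $D_t\ge0$ on $\{p_t<q_t\}$, and $A_t+D_t>0$ on $\{p_t=q_t\}$. -/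

import Mathlib

open MeasureTheory ProbabilityTheory Filter Topology Matrix
open scoped NNReal ENNReal

namespace ForwardPerformance

section MoorePenrose

/-- The four Penrose conditions: `B` is the Moore-Penrose inverse of the real matrix `A`. -/
structure IsMoorePenrose {m n : ℕ} (A : Matrix (Fin m) (Fin n) ℝ)
    (B : Matrix (Fin n) (Fin m) ℝ) : Prop where
  left : A * B * A = A
  right : B * A * B = B
  symm_left : (A * B)ᵀ = A * B
  symm_right : (B * A)ᵀ = B * A

theorem IsMoorePenrose.exists {m n : ℕ} (A : Matrix (Fin m) (Fin n) ℝ) :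
    ∃ B, IsMoorePenrose A B := by
  have hH : (Aᵀ * A).IsHermitian := by
    simpa using Matrix.isHermitian_conjTranspose_mul_self A
  obtain ⟨G, hG1, hG2, hG3, hG4⟩ : ∃ G : Matrix (Fin n) (Fin n) ℝ,
      (Aᵀ * A) * G * (Aᵀ * A) = Aᵀ * A ∧ G * (Aᵀ * A) * G = G ∧ Gᵀ = G ∧
      G * (Aᵀ * A) = (Aᵀ * A) * G := by
    have hs := hH.spectral_theorem
    rw [Unitary.conjStarAlgAut_apply] at hs
    set U : Matrix (Fin n) (Fin n) ℝ := (hH.eigenvectorUnitary : Matrix (Fin n) (Fin n) ℝ)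
    have hU : star U * U = 1 := Unitary.coe_star_mul_self hH.eigenvectorUnitary
    set d : Fin n → ℝ := hH.eigenvalues
    set H := Aᵀ * A
    have hs2 : H = U * diagonal d * star U := hs
    have key : ∀ a b : Fin n → ℝ, (U * diagonal a * star U) * (U * diagonal b * star U)
        = U * diagonal (fun i => a i * b i) * star U := by
      intro a b
      calc (U * diagonal a * star U) * (U * diagonal b * star U)
          = U * diagonal a * (star U * U) * diagonal b * star U := by
            simp only [Matrix.mul_assoc]
        _ = _ := by
            rw [hU, Matrix.mul_one, Matrix.mul_assoc U, diagonal_mul_diagonal]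
    refine ⟨U * diagonal (fun i => (d i)⁻¹) * star U, ?_, ?_, ?_, ?_⟩
    · rw [hs2, key, key]
      congr; funext i; exact mul_inv_mul_cancel (d i)
    · rw [hs2, key, key]
      congr; funext i; by_cases h : d i = 0 <;> simp [h]
    · simp [Matrix.star_eq_conjTranspose, Matrix.mul_assoc]
    · rw [hs2, key, key]
      congr; funext i; exact mul_comm _ _
  have hAGH : A * (G * (Aᵀ * A)) = A := by
    rw [← sub_eq_zero, ← Matrix.conjTranspose_mul_self_eq_zero]
    have hT : (A * (G * (Aᵀ * A)) - A)ᴴ = (Aᵀ * A) * G * Aᵀ - Aᵀ := by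
      simp [Matrix.transpose_mul, hG3, Matrix.mul_assoc]
    rw [hT]
    have e : ((Aᵀ * A) * G * Aᵀ - Aᵀ) * (A * (G * (Aᵀ * A)) - A)
        = ((Aᵀ * A) * G * (Aᵀ * A)) * G * (Aᵀ * A) - (Aᵀ * A) * G * (Aᵀ * A)
          - ((Aᵀ * A) * G * (Aᵀ * A) - Aᵀ * A) := by
      simp only [Matrix.sub_mul, Matrix.mul_sub, Matrix.mul_assoc]
    rw [e, hG1, hG1]; simp
  refine ⟨G * Aᵀ, ?_, ?_, ?_, ?_⟩
  · simpa [Matrix.mul_assoc] using hAGH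
  · rw [show G * Aᵀ * A * (G * Aᵀ) = (G * (Aᵀ * A) * G) * Aᵀ by simp only [Matrix.mul_assoc], hG2]
  · simp [Matrix.transpose_mul, hG3, Matrix.mul_assoc]
  · rw [Matrix.mul_assoc, Matrix.transpose_mul, hG3, Matrix.transpose_mul,
      Matrix.transpose_transpose, hG4]

theorem IsMoorePenrose.unique {m n : ℕ} {A : Matrix (Fin m) (Fin n) ℝ}
    {B C : Matrix (Fin n) (Fin m) ℝ} (hB : IsMoorePenrose A B) (hC : IsMoorePenrose A C) :
    B = C := by
  have h1 : A * B = A * C := by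
    calc A * B = (A * C) * (A * B) := by rw [← Matrix.mul_assoc, hC.left]
      _ = (A * C)ᵀ * (A * B)ᵀ := by rw [hC.symm_left, hB.symm_left]
      _ = ((A * B) * (A * C))ᵀ := by rw [← Matrix.transpose_mul]
      _ = (A * C)ᵀ := by rw [← Matrix.mul_assoc, hB.left]
      _ = A * C := hC.symm_left
  have h2 : B * A = C * A := by
    calc B * A = (B * A) * (C * A) := by
          rw [Matrix.mul_assoc, ← Matrix.mul_assoc A, hC.left]
      _ = (B * A)ᵀ * (C * A)ᵀ := by rw [hC.symm_right, hB.symm_right]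
      _ = ((C * A) * (B * A))ᵀ := by rw [← Matrix.transpose_mul]
      _ = (C * A)ᵀ := by rw [Matrix.mul_assoc, ← Matrix.mul_assoc A, hB.left]
      _ = C * A := hC.symm_right
  calc B = B * A * B := hB.right.symm
    _ = C * A * C := by rw [Matrix.mul_assoc, h1, ← Matrix.mul_assoc, h2]
    _ = C := hC.right

/-- The Moore-Penrose inverse of a real matrix. -/
noncomputable def moorePenrose {m n : ℕ} (A : Matrix (Fin m) (Fin n) ℝ) :
    Matrix (Fin n) (Fin m) ℝ :=
  (IsMoorePenrose.exists A).choose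

end MoorePenrose

section StochasticCalculus

variable {Ω : Type*} [mΩ : MeasurableSpace Ω]

/-- A family of independent standard one-dimensional Brownian motions (that is, a standard
Brownian motion with values in `ℝ^ι`). -/
structure IsStandardBM {ι : Type*} (P : Measure Ω) (B : ι → ℝ≥0 → Ω → ℝ) : Prop where
  brownian : ∀ i, IsBrownianReal (B i) P
  indep : iIndepFun (fun i ω t => B i t ω) P

/-- The filtration generated by the family of processes `B`, augmented by the `P`-null events. -/
def generatedFiltration {ι : Type*} (P : Measure Ω) (B : ι → ℝ≥0 → Ω → ℝ)
    (hB : ∀ i t, Measurable (B i t)) : Filtration ℝ≥0 mΩ where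
  seq t := (⨆ s ≤ t, ⨆ i, MeasurableSpace.comap (B i s) inferInstance) ⊔
    MeasurableSpace.generateFrom {N | MeasurableSet N ∧ P N = 0}
  mono' := fun _ _ hst =>
    sup_le_sup_right (biSup_mono fun _ hr => le_trans hr hst) _
  le' := fun _ => sup_le
    (iSup₂_le fun s _ => iSup_le fun i => (hB i s).comap_le)
    (MeasurableSpace.generateFrom_le fun _ hN => hN.1)

/-- A simple integrand `∑_{k < N} ξ_k 1_{(τ_k, τ_{k+1}]}` with deterministic times `τ_k` and
bounded `𝓕_{τ_k}`-measurable vectors `ξ_k`. -/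
structure SimpleIntegrand (𝓕 : Filtration ℝ≥0 mΩ) (d : ℕ) where
  N : ℕ
  τ : ℕ → ℝ≥0
  mono : Monotone τ
  ξ : ℕ → Ω → Fin d → ℝ
  measurable : ∀ k, StronglyMeasurable[𝓕 (τ k)] (ξ k)
  bounded : ∃ C : ℝ, ∀ k ω j, |ξ k ω j| ≤ C

/-- The value at time `t` of a simple integrand. -/
noncomputable def SimpleIntegrand.value {𝓕 : Filtration ℝ≥0 mΩ} {d : ℕ}
    (V : SimpleIntegrand 𝓕 d) (t : ℝ≥0) (ω : Ω) : Fin d → ℝ :=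
  ∑ k ∈ Finset.range V.N, (Set.Ioc (V.τ k) (V.τ (k + 1))).indicator (fun _ => V.ξ k ω) t

/-- The elementary integral `∫_0^t V · dW` of a simple integrand. -/
noncomputable def SimpleIntegrand.integral {𝓕 : Filtration ℝ≥0 mΩ} {d : ℕ}
    (V : SimpleIntegrand 𝓕 d) (W : Fin d → ℝ≥0 → Ω → ℝ) (t : ℝ≥0) (ω : Ω) : ℝ :=
  ∑ k ∈ Finset.range V.N, ∑ j,
    V.ξ k ω j * (W j (min t (V.τ (k + 1))) ω - W j (min t (V.τ k)) ω)

/-- `Y` is (a version of) the Itô integral process `∫_0^t H_s · dW_s`: it is adapted with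
continuous paths, and it is the limit, uniformly on compact time intervals in probability, of
elementary integrals of simple integrands `V n` with `∫_0^T |V n - H|² ds → 0` in probability
for every `T`. -/
structure IsItoIntegral (𝓕 : Filtration ℝ≥0 mΩ) (P : Measure Ω) {d : ℕ}
    (W : Fin d → ℝ≥0 → Ω → ℝ) (H : ℝ≥0 → Ω → Fin d → ℝ) (Y : ℝ≥0 → Ω → ℝ) : Prop where
  adapted : StronglyAdapted 𝓕 Y
  continuous : ∀ᵐ ω ∂P, Continuous fun t => Y t ω
  approx : ∃ V : ℕ → SimpleIntegrand 𝓕 d, ∀ T : ℝ≥0, ∀ ε : ℝ≥0∞, 0 < ε →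
    Tendsto (fun n => P {ω | ε ≤ ∫⁻ s in Set.Ioc (0 : ℝ) T, ENNReal.ofReal
        (((V n).value s.toNNReal ω - H s.toNNReal ω) ⬝ᵥ
          ((V n).value s.toNNReal ω - H s.toNNReal ω))}) atTop (𝓝 0) ∧
    Tendsto (fun n => P {ω | ε ≤ ⨆ t ∈ Set.Iic T,
        ENNReal.ofReal |(V n).integral W t ω - Y t ω|}) atTop (𝓝 0)

/-- `dX_t = b_t dt + H_t · dW_t`: the process `X` is adapted and continuous, almost surely
`∫_0^T |b_t| dt < ∞` and `∫_0^T |H_t|² dt < ∞` for all `T`, and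
`X_t = X_0 + ∫_0^t b_s ds + ∫_0^t H_s · dW_s` for all `t`. -/
structure HasItoDynamics (𝓕 : Filtration ℝ≥0 mΩ) (P : Measure Ω) {d : ℕ}
    (W : Fin d → ℝ≥0 → Ω → ℝ) (X : ℝ≥0 → Ω → ℝ) (b : ℝ≥0 → Ω → ℝ)
    (H : ℝ≥0 → Ω → Fin d → ℝ) : Prop where
  adapted : StronglyAdapted 𝓕 X
  continuous : ∀ᵐ ω ∂P, Continuous fun t => X t ω
  drift_integrable : ∀ᵐ ω ∂P, ∀ T : ℝ≥0,
    IntegrableOn (fun s : ℝ => b s.toNNReal ω) (Set.Ioc (0 : ℝ) T)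
  diffusion_integrable : ∀ᵐ ω ∂P, ∀ T : ℝ≥0,
    ∫⁻ s in Set.Ioc (0 : ℝ) T,
      ENNReal.ofReal (H s.toNNReal ω ⬝ᵥ H s.toNNReal ω) < ∞
  eq : ∃ Y : ℝ≥0 → Ω → ℝ, IsItoIntegral 𝓕 P W H Y ∧
    ∀ᵐ ω ∂P, ∀ t : ℝ≥0, X t ω = X 0 ω + (∫ s in Set.Ioc (0 : ℝ) t, b s.toNNReal ω) + Y t ω

end StochasticCalculus

section Market

variable {Ω : Type*} [mΩ : MeasurableSpace Ω]

/-- The driving noise: a `dW`-dimensional and a `dP`-dimensional Brownian motion, jointly forming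
a standard Brownian motion. -/
structure DrivingNoise (P : Measure Ω) (dW dP : ℕ) where
  W : Fin dW → ℝ≥0 → Ω → ℝ
  Wperp : Fin dP → ℝ≥0 → Ω → ℝ
  measurable : ∀ i t, Measurable (Sum.elim W Wperp i t)
  brownian : IsStandardBM P (Sum.elim W Wperp)

/-- The (augmented) filtration generated by the pair of Brownian motions. -/
def DrivingNoise.filtration {P : Measure Ω} {dW dP : ℕ} (B : DrivingNoise P dW dP) :
    Filtration ℝ≥0 mΩ :=
  generatedFiltration P (Sum.elim B.W B.Wperp) B.measurable

/-- The market: a bank account with zero interest rate and `n` stocks with prices `S i` following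
`dS^i / S^i = μ^i dt + ∑_j σ^{ji} dW^j`, where `μ` and `σ` are continuous and adapted and where
the Sharpe ratio `(σ⁺)ᵀ μ` is bounded on each `[0,T]` almost surely. -/
structure Market (P : Measure Ω) (n dW dP : ℕ) extends DrivingNoise P dW dP where
  μ : ℝ≥0 → Ω → Fin n → ℝ
  σ : ℝ≥0 → Ω → Matrix (Fin dW) (Fin n) ℝ
  μ_adapted : StronglyAdapted toDrivingNoise.filtration μ
  σ_adapted : StronglyAdapted toDrivingNoise.filtration σ
  μ_continuous : ∀ᵐ ω ∂P, Continuous fun t => μ t ω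
  σ_continuous : ∀ᵐ ω ∂P, Continuous fun t => σ t ω
  S : Fin n → ℝ≥0 → Ω → ℝ
  S_pos : ∀ i, ∀ᵐ ω ∂P, ∀ t, 0 < S i t ω
  S_dynamics : ∀ i, HasItoDynamics toDrivingNoise.filtration P W (S i)
    (fun t ω => S i t ω * μ t ω i) (fun t ω j => S i t ω * σ t ω j i)
  sharpe_bounded : ∀ᵐ ω ∂P, ∀ T : ℝ≥0, ∃ C : ℝ, ∀ t ≤ T,
    ‖(moorePenrose (σ t ω))ᵀ *ᵥ μ t ω‖ ≤ C

variable {P : Measure Ω} {n dW dP : ℕ}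

/-- The filtration of the market. -/
def Market.𝓕 (M : Market P n dW dP) : Filtration ℝ≥0 mΩ := M.toDrivingNoise.filtration

/-- The Sharpe ratio `λ = (σ⁺)ᵀ μ`. -/
noncomputable def Market.sharpe (M : Market P n dW dP) (t : ℝ≥0) (ω : Ω) : Fin dW → ℝ :=
  (moorePenrose (M.σ t ω))ᵀ *ᵥ M.μ t ω

/-- `X` is the wealth process, with initial capital `x`, of the portfolio `π` (in fractions of
current wealth): `dX = X (σ π)ᵀ λ dt + X (σ π)ᵀ dW`, `X_0 = x`. -/
structure Market.IsWealth (M : Market P n dW dP) (x : ℝ) (π : ℝ≥0 → Ω → Fin n → ℝ)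
    (X : ℝ≥0 → Ω → ℝ) : Prop where
  init : ∀ᵐ ω ∂P, X 0 ω = x
  dynamics : HasItoDynamics M.𝓕 P M.W X
    (fun t ω => X t ω * ((M.σ t ω *ᵥ π t ω) ⬝ᵥ M.sharpe t ω))
    (fun t ω => X t ω • (M.σ t ω *ᵥ π t ω))

/-- `T`-admissibility of a progressively measurable portfolio `π` with wealth process `X`. -/
structure Market.IsAdmissibleUpTo (M : Market P n dW dP) (x : ℝ) (T : ℝ≥0)
    (π : ℝ≥0 → Ω → Fin n → ℝ) (X : ℝ≥0 → Ω → ℝ) : Prop where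
  progressive : IsStronglyProgressive M.𝓕 π
  wealth : M.IsWealth x π X
  nonneg : ∀ᵐ ω ∂P, ∀ t ≤ T, 0 ≤ X t ω
  drift : ∀ᵐ ω ∂P, ∀ t ≤ T, ∫⁻ s in Set.Ioc (0 : ℝ) t,
    ENNReal.ofReal |X s.toNNReal ω * (π s.toNNReal ω ⬝ᵥ M.μ s.toNNReal ω)| < ∞
  diffusion : ∀ᵐ ω ∂P, ∀ t ≤ T, ∫⁻ s in Set.Ioc (0 : ℝ) t,
    ENNReal.ofReal ((X s.toNNReal ω • (M.σ s.toNNReal ω *ᵥ π s.toNNReal ω)) ⬝ᵥ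
      (X s.toNNReal ω • (M.σ s.toNNReal ω *ᵥ π s.toNNReal ω))) < ∞

/-- Forward admissibility: `π ∈ 𝒜`, with wealth process `X`, if it is `T`-admissible for every
`T > 0`. -/
def Market.IsAdmissible (M : Market P n dW dP) (x : ℝ) (π : ℝ≥0 → Ω → Fin n → ℝ)
    (X : ℝ≥0 → Ω → ℝ) : Prop :=
  ∀ T : ℝ≥0, 0 < T → M.IsAdmissibleUpTo x T π X

/-- `U` is a forward performance process for an investor with initial capital `x`. A random field
is a function `U t ω y` of time, scenario and wealth. Its wealth argument ranges over `(0,∞)`;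
only for evaluation along wealth processes that reach zero does the value at `y = 0` matter, where
`U` stands for its continuous extension. -/
structure Market.IsForwardPerformance (M : Market P n dW dP) (x : ℝ)
    (U : ℝ≥0 → Ω → ℝ → ℝ) : Prop where
  progressive : ∀ y : ℝ, 0 < y → IsStronglyProgressive M.𝓕 fun t ω => U t ω y
  utility : ∀ᵐ ω ∂P, ∀ t, StrictConcaveOn ℝ (Set.Ioi 0) (U t ω) ∧
    StrictMonoOn (U t ω) (Set.Ioi 0)
  supermartingale : ∀ π X, M.IsAdmissible x π X →
    Supermartingale (fun t ω => U t ω (X t ω)) M.𝓕 P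
  martingale : ∃ π X, M.IsAdmissible x π X ∧
    Martingale (fun t ω => U t ω (X t ω)) M.𝓕 P

end Market

/-- The two-power mixture random field `U_t(x) = A_t x^{p_t} + D_t x^{q_t}`. For positive powers
its value at `x = 0` is `0`, the continuous extension. -/
noncomputable def twoPowerMixture {Ω : Type*} (A D p q : ℝ≥0 → Ω → ℝ) (t : ℝ≥0) (ω : Ω)
    (x : ℝ) : ℝ :=
  A t ω * x ^ p t ω + D t ω * x ^ q t ω

end ForwardPerformance

/-! The claim is pathwise. Off one null set that serves all times at once, fix the scenario and the
time; what remains is a statement about a strictly increasing function `f x = a * x ^ p + d * x ^ q`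
on `(0, ∞)`. Both powers are positive, so `f` tends to `0` at the origin and monotonicity forces `f
≥ 0`. When `p < q`, the sign of `f` near the origin is governed by `a` and at infinity by `d`, so
neither coefficient can be negative. When `p = q`, `f` is the single power `(a + d) * x ^ q`, which
is strictly increasing only if `a + d > 0`. -/

/-- A two-power mixture that is increasing on `(0, ∞)` is nonnegative there, because it vanishes
at the origin. -/
theorem nonneg_rpow_mixture_of_monotoneOn {a d p q : ℝ} (hp : 0 < p) (hq : 0 < q)
    (h : MonotoneOn (fun x : ℝ => a * x ^ p + d * x ^ q) (Set.Ioi 0)) {x : ℝ} (hx : 0 < x) :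
    0 ≤ a * x ^ p + d * x ^ q := by
  have hc : Continuous fun y : ℝ => a * y ^ p + d * y ^ q :=
    ((Real.continuous_rpow_const hp.le).const_mul a).add
      ((Real.continuous_rpow_const hq.le).const_mul d)
  -- The value at the origin is `0` only because the exponents are nonzero: `0 ^ 0 = 1` for `rpow`.
  have hlim : Tendsto (fun y : ℝ => a * y ^ p + d * y ^ q) (𝓝[>] 0) (𝓝 0) := by
    simpa [Real.zero_rpow hp.ne', Real.zero_rpow hq.ne'] using
      (hc.tendsto 0).mono_left nhdsWithin_le_nhds
  refine le_of_tendsto hlim ?_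
  filter_upwards [Ioo_mem_nhdsGT hx] with y hy using h hy.1 hx hy.2.le

/-- If `a x ^ p + d x ^ q ≥ 0` for all `x > 0`, where `p < q`, then both coefficients are
nonnegative: `a` dominates near the origin and `d` at infinity. -/
theorem coeff_nonneg_of_rpow_mixture_nonneg {a d p q : ℝ} (hpq : p < q)
    (h : ∀ x : ℝ, 0 < x → 0 ≤ a * x ^ p + d * x ^ q) : 0 ≤ a ∧ 0 ≤ d := by
  have hr : 0 < q - p := sub_pos.2 hpq
  constructor
  -- This is the mixture divided by `x ^ p`; the sign is unchanged and the second term vanishes at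
  -- the origin because `q - p > 0`.
  · have hlim : Tendsto (fun x : ℝ => a + d * x ^ (q - p)) (𝓝[>] 0) (𝓝 a) := by
      have hc : Continuous fun x : ℝ => a + d * x ^ (q - p) :=
        continuous_const.add ((Real.continuous_rpow_const hr.le).const_mul d)
      simpa [Real.zero_rpow hr.ne'] using (hc.tendsto 0).mono_left nhdsWithin_le_nhds
    refine ge_of_tendsto hlim ?_
    filter_upwards [self_mem_nhdsWithin] with x hx
    have hx : 0 < x := hx
    refine nonneg_of_mul_nonneg_left ?_ (Real.rpow_pos_of_pos hx p)
    rw [add_mul, mul_assoc, ← Real.rpow_add hx, sub_add_cancel]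
    exact h x hx
  -- Division by `x ^ q` instead: the first term now carries a negative exponent and vanishes at
  -- infinity.
  · have hlim : Tendsto (fun x : ℝ => a * x ^ (-(q - p)) + d) atTop (𝓝 d) := by
      simpa using ((tendsto_rpow_neg_atTop hr).const_mul a).add_const d
    refine ge_of_tendsto hlim ?_
    filter_upwards [eventually_gt_atTop 0] with x hx
    refine nonneg_of_mul_nonneg_left ?_ (Real.rpow_pos_of_pos hx q)
    rw [add_mul, mul_assoc, ← Real.rpow_add hx, neg_sub, sub_add_cancel]
    exact h x hx

theorem lemma4p1 {Ω : Type*} [mΩ : MeasurableSpace Ω] (P : Measure Ω) [IsProbabilityMeasure P]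
    {n dW dP : ℕ} (hn : 1 ≤ n) (hdW : 1 ≤ dW)
    (M : ForwardPerformance.Market P n dW dP) (x : ℝ) (hx : 0 < x)
    (A D p q : ℝ≥0 → Ω → ℝ)
    (hA : StronglyAdapted M.𝓕 A) (hD : StronglyAdapted M.𝓕 D)
    (hp : StronglyAdapted M.𝓕 p) (hq : StronglyAdapted M.𝓕 q)
    (hAc : ∀ᵐ ω ∂P, Continuous fun t => A t ω) (hDc : ∀ᵐ ω ∂P, Continuous fun t => D t ω)
    (hpc : ∀ᵐ ω ∂P, Continuous fun t => p t ω) (hqc : ∀ᵐ ω ∂P, Continuous fun t => q t ω)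
    (hp01 : ∀ᵐ ω ∂P, ∀ t, 0 < p t ω ∧ p t ω < 1)
    (hq01 : ∀ᵐ ω ∂P, ∀ t, 0 < q t ω ∧ q t ω < 1)
    (hpq : ∀ᵐ ω ∂P, ∀ t, p t ω ≤ q t ω)
    (hU : M.IsForwardPerformance x (ForwardPerformance.twoPowerMixture A D p q)) :
    ∀ᵐ ω ∂P, ∀ t : ℝ≥0,
      (p t ω < q t ω → 0 ≤ A t ω ∧ 0 ≤ D t ω) ∧
      (p t ω = q t ω → 0 < A t ω + D t ω) := by
  filter_upwards [hp01, hq01, hU.utility] with ω hpω hqω hUω t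
  have hmono : StrictMonoOn (fun y : ℝ => A t ω * y ^ p t ω + D t ω * y ^ q t ω) (Set.Ioi 0) :=
    (hUω t).2
  refine ⟨fun hlt => coeff_nonneg_of_rpow_mixture_nonneg hlt fun y hy =>
    nonneg_rpow_mixture_of_monotoneOn (hpω t).1 (hqω t).1 hmono.monotoneOn hy, fun heq => ?_⟩
  -- For equal powers two points suffice: comparing `y = 1` with `y = 2` gives `A + D < (A + D) * 2
  -- ^ q`, that is `(A + D) * (2 ^ q - 1) > 0`, where `2 ^ q > 1`.
  have h12 := hmono (Set.mem_Ioi.2 one_pos) (Set.mem_Ioi.2 two_pos) one_lt_two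
  have h2 : 1 < (2 : ℝ) ^ q t ω := Real.one_lt_rpow one_lt_two (hqω t).1
  simp only [heq, Real.one_rpow, mul_one] at h12
  refine pos_of_mul_pos_left ?_ (sub_pos.2 h2).le
  linarith
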